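/- Let $\mathcal A$ be a finite alphabet. A labelled graph is a finite directed graph (loops and parallel edges allowed) whose edges carry labels in $\mathcal A$. Let $\mathcal X\subseteq\mathcal A^{\mathbb Z}$ be an irreducible sofic shift, i.e. the set of labels of bi-infinite paths of a labelled graph, such that for all words $u,v$ of $\mathcal X$, either $uv$ is a word of $\mathcal X$ or $uwv$ is a word of $\mathcal X$ for some word $w$ of $\mathcal X$. Let $\mathcal G$ be the minimal right-resolving presentation of $\mathcal X$: a labelled graph without sources and sinks that presents $\mathcal X$, in which distinct edges leaving the same vertex have distinct labels, and which has the fewest vertices among all such presentations of $\mathcal X$. Let $V$ be its vertex set, linearly ordered, $S=|V|$, and let $\lambda$ be the spectral radius of its adjacency matrix (whose $(u,v)$ entry is the number of edges from $u$ to $v$). For $v\in V$ and $a\in\mathcal A$ let $v(a)$ be the terminal vertex of the edge leaving $v$ with label $a$, if there is one. For $1\le j\le S$ let $\mathcal G_j$ be the following labelled graph. Its vertices are the $j$-element subsets of $V$. For each $a\in\mathcal A$ there is an edge from $\{v_1<\dots<v_j\}$ to $\{\tilde v_1<\dots<\tilde v_j\}$ if $v_1(a),\dots,v_j(a)$ are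 all defined, distinct and contained in $\{\tilde v_1,\dots,\tilde v_j\}$; its label is $a$ if $(v_1(a),\dots,v_j(a))$ is an even permutation of $(\tilde v_1,\dots,\tilde v_j)$, and $-a$ otherwise. Let $\tilde{\mathcal G}_j$ be $\mathcal G_j$ with every negative label $-a$ replaced by $a$, and let $\tilde A_j$ be its adjacency matrix. Then $\rho(\tilde A_j)<\lambda$ for every $j$ with $2\le j\le S$, where $\rho$ denotes the spectral radius. -/

import Mathlib

/-- A directed graph with vertices `V`, edges `E` (parallel edges and loops are allowed), each edge
carrying a label in `A`. -/
structure LabelledGraph (V E A : Type*) where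
  /-- The initial vertex of an edge. -/
  init : E → V
  /-- The terminal vertex of an edge. -/
  term : E → V
  /-- The label of an edge. -/
  label : E → A

/-- The set of words (finite sequences) occurring in the points of `X`. -/
def words {A : Type*} (X : Set (ℤ → A)) : Set (List A) :=
  {w | ∃ x ∈ X, ∃ k : ℤ, ∀ (i : ℕ) (hi : i < w.length), x (k + i) = w[i]}

/-- Irreducibility of a shift space. -/
def IsIrreducibleShift {A : Type*} (X : Set (ℤ → A)) : Prop :=
  ∀ u ∈ words X, ∀ v ∈ words X, u ++ v ∈ words X ∨ ∃ w ∈ words X, u ++ w ++ v ∈ words X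

namespace LabelledGraph

/-- No vertex is a source or a sink. -/
def IsEssential {V E A : Type*} (G : LabelledGraph V E A) : Prop :=
  ∀ v : V, (∃ e, G.term e = v) ∧ (∃ e, G.init e = v)

/-- Distinct edges leaving the same vertex have distinct labels. -/
def IsRightResolving {V E A : Type*} (G : LabelledGraph V E A) : Prop :=
  ∀ e e' : E, G.init e = G.init e' → G.label e = G.label e' → e = e'

/-- The set of bi-infinite paths. -/
def biinfinitePaths {V E A : Type*} (G : LabelledGraph V E A) : Set (ℤ → E) :=
  {p | ∀ k : ℤ, G.term (p k) = G.init (p (k + 1))}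

/-- The sofic shift presented by a (finite) labelled graph: the set of labels of its bi-infinite
paths. -/
def soficShift {V E A : Type*} (G : LabelledGraph V E A) : Set (ℤ → A) :=
  {x | ∃ p ∈ G.biinfinitePaths, x = fun k => G.label (p k)}

/-- `G` is a right-resolving presentation of `X` (without sources and sinks). -/
structure IsRightResolvingPresentation {V E A : Type*} (G : LabelledGraph V E A)
    (X : Set (ℤ → A)) : Prop where
  essential : G.IsEssential
  rightResolving : G.IsRightResolving
  presents : G.soficShift = X

/-- `G` has the fewest vertices among all finite right-resolving presentations of `X`. -/
structure IsMinimalRightResolvingPresentation {V : Type*} {E : Type*} {A : Type*}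
    (G : LabelledGraph V E A) (X : Set (ℤ → A)) : Prop
    extends G.IsRightResolvingPresentation X where
  minimal : ∀ (V' : Type) (E' : Type) [Finite V'] [Finite E'] (G' : LabelledGraph V' E' A),
    G'.IsRightResolvingPresentation X → Nat.card V ≤ Nat.card V'

/-- The adjacency matrix: the `(u, v)` entry is the number of edges from `u` to `v`. -/
noncomputable def adjMatrix {V E A : Type*} (G : LabelledGraph V E A) : Matrix V V ℂ :=
  Matrix.of fun u v => (Nat.card {e : E // G.init e = u ∧ G.term e = v} : ℂ)

open scoped Classical in
/-- The vertex `v(a)`: the terminal vertex of the edge leaving `v` with label `a` (unique when `G`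
is right-resolving), and `none` if there is no such edge. -/
noncomputable def next {V E A : Type*} (G : LabelledGraph V E A) (v : V) (a : A) : Option V :=
  if h : ∃ e, G.init e = v ∧ G.label e = a then some (G.term h.choose) else none

/-- The sets of `j` distinct vertices. -/
abbrev Subsets (V : Type*) (j : ℕ) : Type _ := {s : Finset V // s.card = j}

/-- There is an edge for `a` from `s` to `t` when all `v(a)`, `v ∈ s`, are defined, contained in `t`
and distinct. -/
def IsSubsetEdge {V E A : Type*} (G : LabelledGraph V E A) {j : ℕ} (s : Subsets V j) (a : A)
    (t : Subsets V j) : Prop :=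
  (∀ v ∈ s.1, ∃ u ∈ t.1, G.next v a = some u) ∧
    ∀ v ∈ s.1, ∀ v' ∈ s.1, G.next v a = G.next v' a → v = v'

/-- With `s = {v₁ < … < v_j}` and `t = {t₁ < … < t_j}`, the tuple `(v₁(a), …, v_j(a))` is an even
permutation of `(t₁, …, t_j)`. -/
def IsEvenEdge {V E A : Type*} [LinearOrder V] (G : LabelledGraph V E A) {j : ℕ}
    (s : Subsets V j) (a : A) (t : Subsets V j) : Prop :=
  ∃ π : Equiv.Perm (Fin j), Equiv.Perm.sign π = 1 ∧
    ∀ i : Fin j, G.next (s.1.orderEmbOfFin s.2 i) a = some (t.1.orderEmbOfFin t.2 (π i))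

/-- The edges of the `j`-subset graph. -/
abbrev SubsetEdges {V E A : Type*} (G : LabelledGraph V E A) (j : ℕ) : Type _ :=
  {e : Subsets V j × A × Subsets V j // G.IsSubsetEdge e.1 e.2.1 e.2.2}

open scoped Classical in
/-- The `j`-subset graph. The labels `a` and `-a` are encoded as `(a, 1)` and `(a, -1)`. -/
noncomputable def subsetGraph {V E A : Type*} [LinearOrder V] (G : LabelledGraph V E A) (j : ℕ) :
    LabelledGraph (Subsets V j) (G.SubsetEdges j) (A × ℤˣ) where
  init e := e.1.1
  term e := e.1.2.2
  label e := (e.1.2.1, if G.IsEvenEdge e.1.1 e.1.2.1 e.1.2.2 then 1 else -1)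

/-- The `j`-subset graph with all negative labels made positive. -/
noncomputable def positiveSubsetGraph {V E A : Type*} [LinearOrder V] (G : LabelledGraph V E A)
    (j : ℕ) : LabelledGraph (Subsets V j) (G.SubsetEdges j) A where
  init := (G.subsetGraph j).init
  term := (G.subsetGraph j).term
  label e := ((G.subsetGraph j).label e).1

end LabelledGraph

/-!
By minimality, `G` is irreducible (a vertex not forced by some word of `X` could be deleted) and
distinct vertices have distinct follower sets (otherwise they could be identified). Let `r` be a
positive Perron eigenvector of `G`, with eigenvalue `c ≤ λ`, and give a `j`-subset `s` the
weight `f s = ∑ v ∈ s, r v`. If the subset graph has an edge from `s` to `t` with letter `a`,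
then the edges of `G` from `s` labelled `a` end bijectively in `t`; hence `Ã_j f ≤ c f`, with
equality at `s` only if every edge of `G` leaving `s` extends to an edge of the subset graph. If
`ρ(Ã_j) ≥ λ`, the maximum principle applied to an eigenvector of `Ã_j` gives a nonempty family
of subsets where equality holds and which is closed under the edges of the subset graph. But
then all vertices of such a subset have the same follower set, which is impossible for `j ≥ 2`.
-/

open Filter Matrix

/-- Compactness: `E` is finite, so sequences that satisfy the constraints on longer and longer
windows have a limit along an ultrafilter. -/
theorem exists_biinfinite_of_forall_window {E : Type*} [Finite E] (P : ℤ → E → E → Prop)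
    (h : ∀ n : ℕ, ∃ p : ℤ → E, ∀ k : ℤ, -(n : ℤ) ≤ k → k ≤ n → P k (p k) (p (k + 1))) :
    ∃ p : ℤ → E, ∀ k, P k (p k) (p (k + 1)) := by
  choose p hp using h
  have eventually_const (k : ℤ) : ∃ e : E, ∀ᶠ n in (hyperfilter ℕ : Filter ℕ), p n k = e := by
    rw [← Ultrafilter.eventually_exists_iff]
    exact .of_forall fun n => ⟨_, rfl⟩
  choose q hq using eventually_const
  refine ⟨q, fun k => ?_⟩
  have hlarge : ∀ᶠ n in (hyperfilter ℕ : Filter ℕ), k.natAbs ≤ n :=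
    (eventually_ge_atTop _).filter_mono (hyperfilter_le_cofinite.trans_eq Nat.cofinite_eq_atTop)
  obtain ⟨n, hk, hk', hn⟩ := ((hq k).and ((hq (k + 1)).and hlarge)).exists
  rw [← hk, ← hk']
  exact hp n k (by omega) (by omega)

/-- The word of length `n` that occurs in `x` at position `k`. -/
def window {A : Type*} (x : ℤ → A) (k : ℤ) (n : ℕ) : List A :=
  List.ofFn fun i : Fin n => x (k + i)

theorem window_succ {A : Type*} (x : ℤ → A) (k : ℤ) (n : ℕ) :
    window x k (n + 1) = x k :: window x (k + 1) n := by
  simp [window, List.ofFn_succ, add_assoc, add_comm (1 : ℤ)]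

theorem mem_words_iff_exists_window {A : Type*} {X : Set (ℤ → A)} {w : List A} :
    w ∈ words X ↔ ∃ x ∈ X, ∃ k n, window x k n = w := by
  constructor
  · rintro ⟨x, hx, k, hw⟩
    exact ⟨x, hx, k, w.length, List.ext_getElem (by simp [window]) fun i _ hi => by
      simp [window, hw i hi]⟩
  · rintro ⟨x, hx, k, n, rfl⟩
    exact ⟨x, hx, k, fun i _ => by simp [window]⟩

namespace LabelledGraph

section Paths

variable {V E A : Type*}

/-- `G.IsPath u w v`: the word `w` labels a path of `G` from `u` to `v`. -/
inductive IsPath (G : LabelledGraph V E A) : V → List A → V → Prop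
  | nil (v : V) : G.IsPath v [] v
  | cons (e : E) {w : List A} {v : V} : G.IsPath (G.term e) w v →
    G.IsPath (G.init e) (G.label e :: w) v

/-- Irreducibility of a graph: every vertex can be reached from every vertex. As in
`Matrix.IsIrreducible`, the paths are required to have at least one edge. -/
def IsIrreducible (G : LabelledGraph V E A) : Prop :=
  ∀ u v, ∃ w ≠ [], G.IsPath u w v

/-- The follower set of a vertex `v`: the labels of the paths starting at `v`. -/
def followerSet (G : LabelledGraph V E A) (v : V) : Set (List A) :=
  {w | ∃ u, G.IsPath v w u}

/-- The labels of all finite paths. Unlike `words G.soficShift`, this includes paths that do not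
extend to bi-infinite ones. -/
def language (G : LabelledGraph V E A) : Set (List A) :=
  ⋃ v, G.followerSet v

variable {G : LabelledGraph V E A} {X : Set (ℤ → A)}

theorem isPath_nil_iff {u v : V} : G.IsPath u [] v ↔ u = v :=
  ⟨fun h => by cases h; rfl, fun h => h ▸ .nil u⟩

theorem isPath_cons_iff {u v : V} {a : A} {w : List A} :
    G.IsPath u (a :: w) v ↔ ∃ e, G.init e = u ∧ G.label e = a ∧ G.IsPath (G.term e) w v := by
  constructor
  · rintro ⟨⟩
    exact ⟨_, rfl, rfl, ‹_›⟩
  · rintro ⟨e, rfl, rfl, h⟩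
    exact h.cons e

theorem isPath_append_iff {u v : V} {w₁ w₂ : List A} :
    G.IsPath u (w₁ ++ w₂) v ↔ ∃ m, G.IsPath u w₁ m ∧ G.IsPath m w₂ v := by
  induction w₁ generalizing u with
  | nil => simp [isPath_nil_iff]
  | cons a w₁ ih =>
    simp only [List.cons_append, isPath_cons_iff, ih]
    tauto

theorem nil_mem_followerSet (v : V) : [] ∈ G.followerSet v :=
  ⟨v, .nil v⟩

theorem cons_mem_followerSet_iff {v : V} {a : A} {w : List A} :
    a :: w ∈ G.followerSet v ↔
      ∃ e, G.init e = v ∧ G.label e = a ∧ w ∈ G.followerSet (G.term e) := by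
  simp only [followerSet, Set.mem_ofPred_eq, isPath_cons_iff]
  tauto

theorem IsRightResolving.cons_mem_followerSet_init_iff (hG : G.IsRightResolving) (e : E)
    {w : List A} : G.label e :: w ∈ G.followerSet (G.init e) ↔ w ∈ G.followerSet (G.term e) := by
  rw [cons_mem_followerSet_iff]
  refine ⟨?_, fun h => ⟨e, rfl, rfl, h⟩⟩
  rintro ⟨e', hinit, hlabel, h⟩
  rwa [hG e' e hinit hlabel] at h

theorem mem_language_iff {w : List A} : w ∈ G.language ↔ ∃ u v, G.IsPath u w v := by
  simp [language, followerSet]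

theorem window_mem_followerSet {p : ℤ → E} (hp : p ∈ G.biinfinitePaths) (k : ℤ) (n : ℕ) :
    window (fun i => G.label (p i)) k n ∈ G.followerSet (G.init (p k)) := by
  induction n generalizing k with
  | zero => exact nil_mem_followerSet _
  | succ n ih =>
    rw [window_succ, cons_mem_followerSet_iff]
    exact ⟨p k, rfl, rfl, hp k ▸ ih (k + 1)⟩

theorem IsPath.exists_vertices_edges [Nonempty E] {u v : V} {w : List A} (h : G.IsPath u w v) :
    ∃ (q : ℕ → V) (p : ℕ → E), q 0 = u ∧ ∀ i (hi : i < w.length),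
      G.init (p i) = q i ∧ G.term (p i) = q (i + 1) ∧ G.label (p i) = w[i] := by
  induction h with
  | nil v => exact ⟨fun _ => v, fun _ => Classical.arbitrary E, rfl, by simp⟩
  | cons e _ ih =>
    obtain ⟨q, p, hq, hp⟩ := ih
    refine ⟨fun i => i.casesOn (G.init e) q, fun i => i.casesOn e p, rfl, ?_⟩
    rintro (_ | i) hi
    · exact ⟨rfl, hq.symm, rfl⟩
    · exact hp i (Nat.lt_of_succ_lt_succ hi)

theorem mem_soficShift_iff [Finite E] {x : ℤ → A} :
    x ∈ G.soficShift ↔ ∀ k n, window x k n ∈ G.language := by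
  constructor
  · rintro ⟨p, hp, rfl⟩ k n
    exact Set.mem_iUnion.2 ⟨_, window_mem_followerSet hp k n⟩
  intro h
  obtain ⟨_, _, hpath⟩ := mem_language_iff.1 (h 0 1)
  obtain ⟨e, -⟩ := isPath_cons_iff.1 (window_succ x 0 0 ▸ hpath)
  have : Nonempty E := ⟨e⟩
  obtain ⟨p, hp⟩ := exists_biinfinite_of_forall_window
    (fun k e e' => G.term e = G.init e' ∧ G.label e = x k) (by
      intro n
      obtain ⟨_, _, hpath⟩ := mem_language_iff.1 (h (-n) (2 * n + 2))
      obtain ⟨q, p, -, hp⟩ := hpath.exists_vertices_edges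
      simp only [window, List.length_ofFn, List.getElem_ofFn] at hp
      refine ⟨fun k => p (k + n).toNat, fun k hk hk' => ?_⟩
      obtain ⟨i, rfl⟩ : ∃ i : ℕ, k = -n + i := ⟨(k + n).toNat, by omega⟩
      have hi : (-(n : ℤ) + i + n).toNat = i := by omega
      have hi' : (-(n : ℤ) + i + 1 + n).toNat = i + 1 := by omega
      obtain ⟨-, hterm, hlabel⟩ := hp i (by omega)
      obtain ⟨hinit, -⟩ := hp (i + 1) (by omega)
      simp only [hi, hi']
      exact ⟨hterm.trans hinit.symm, hlabel⟩)
  exact ⟨p, fun k => (hp k).1, funext fun k => (hp k).2.symm⟩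

theorem words_soficShift_subset_language : words G.soficShift ⊆ G.language := by
  intro w hw
  obtain ⟨_, ⟨p, hp, rfl⟩, k, n, rfl⟩ := mem_words_iff_exists_window.1 hw
  exact Set.mem_iUnion.2 ⟨_, window_mem_followerSet hp k n⟩

end Paths

section Minimality

variable {V E A V' E' : Type*}

/-- The isomorphic copy of `G` along bijections of the vertices and edges, which moves a
presentation between universes. -/
def reindex (G : LabelledGraph V E A) (f : V ≃ V') (g : E ≃ E') : LabelledGraph V' E' A where
  init e := f (G.init (g.symm e))
  term e := f (G.term (g.symm e))
  label e := G.label (g.symm e)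

/-- The essential part of `G`: the vertices and edges that lie on bi-infinite paths. -/
def essentialPart (G : LabelledGraph V E A) :
    LabelledGraph {v : V // ∃ p ∈ G.biinfinitePaths, ∃ k, G.init (p k) = v}
      {e : E // ∃ p ∈ G.biinfinitePaths, ∃ k, p k = e} A where
  init e := ⟨G.init e, by
    obtain ⟨_, p, hp, k, rfl⟩ := e
    exact ⟨p, hp, k, rfl⟩⟩
  term e := ⟨G.term e, by
    obtain ⟨_, p, hp, k, rfl⟩ := e
    exact ⟨p, hp, k + 1, (hp k).symm⟩⟩
  label e := G.label e

/-- The graph `G` without the vertex `v` and the edges that start or end there. -/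
def deleteVertex (G : LabelledGraph V E A) (v : V) :
    LabelledGraph {u : V // u ≠ v} {e : E // G.init e ≠ v ∧ G.term e ≠ v} A where
  init e := ⟨G.init e, e.2.1⟩
  term e := ⟨G.term e, e.2.2⟩
  label e := G.label e

/-- The follower set graph, obtained from `G` by identifying the vertices that have the same
follower set. -/
def followerSetGraph (G : LabelledGraph V E A) :
    LabelledGraph (Set.range G.followerSet)
      (Set.range fun e => (G.followerSet (G.init e), G.label e, G.followerSet (G.term e))) A where
  init ε := ⟨ε.1.1, by
    obtain ⟨_, e, rfl⟩ := ε
    exact ⟨_, rfl⟩⟩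
  term ε := ⟨ε.1.2.2, by
    obtain ⟨_, e, rfl⟩ := ε
    exact ⟨_, rfl⟩⟩
  label ε := ε.1.2.1

variable {G : LabelledGraph V E A} {X : Set (ℤ → A)}

theorem IsRightResolvingPresentation.reindex (hG : G.IsRightResolvingPresentation X) (f : V ≃ V')
    (g : E ≃ E') : (G.reindex f g).IsRightResolvingPresentation X where
  essential v := by
    obtain ⟨⟨e, he⟩, ⟨e', he'⟩⟩ := hG.essential (f.symm v)
    exact ⟨⟨g e, by simp [LabelledGraph.reindex, he]⟩, ⟨g e', by simp [LabelledGraph.reindex, he']⟩⟩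
  rightResolving e e' hinit hlabel :=
    g.symm.injective (hG.rightResolving _ _ (f.injective hinit) hlabel)
  presents := by
    rw [← hG.presents]
    ext x
    constructor
    · rintro ⟨p, hp, rfl⟩
      exact ⟨fun k => g.symm (p k), fun k => f.injective (hp k), rfl⟩
    · rintro ⟨p, hp, rfl⟩
      exact ⟨fun k => g (p k), fun k => by simpa [LabelledGraph.reindex] using hp k,
        by simp [LabelledGraph.reindex]⟩

theorem IsRightResolving.essentialPart_isRightResolvingPresentation (hG : G.IsRightResolving) :
    G.essentialPart.IsRightResolvingPresentation G.soficShift where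
  essential := by
    rintro ⟨_, p, hp, k, rfl⟩
    refine ⟨⟨⟨p (k - 1), p, hp, k - 1, rfl⟩, Subtype.ext ?_⟩, ⟨⟨p k, p, hp, k, rfl⟩, rfl⟩⟩
    exact (hp (k - 1)).trans (by rw [sub_add_cancel])
  rightResolving e e' hinit hlabel :=
    Subtype.ext (hG _ _ (congrArg Subtype.val hinit) hlabel)
  presents := by
    ext x
    constructor
    · rintro ⟨p, hp, rfl⟩
      exact ⟨fun k => (p k).1, fun k => congrArg Subtype.val (hp k), rfl⟩
    · rintro ⟨p, hp, rfl⟩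
      exact ⟨fun k => ⟨p k, p, hp, k, rfl⟩, fun k => Subtype.ext (hp k), rfl⟩

theorem IsMinimalRightResolvingPresentation.card_le [Finite V'] [Finite E']
    (hG : G.IsMinimalRightResolvingPresentation X) {G' : LabelledGraph V' E' A}
    (hG' : G'.IsRightResolving) (hX : G'.soficShift = X) : Nat.card V ≤ Nat.card V' := by
  subst hX
  have hle := hG.minimal _ _ _ (hG'.essentialPart_isRightResolvingPresentation.reindex
    (Finite.equivFin _) (Finite.equivFin _))
  rw [Nat.card_fin] at hle
  exact hle.trans (Finite.card_subtype_le _)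

theorem IsPath.visits_or_isPath_deleteVertex {u u' : V} {w : List A} (h : G.IsPath u w u')
    (v : V) : (∃ w₁ w₂, G.IsPath u w₁ v ∧ G.IsPath v w₂ u') ∨
      ∃ (hu : u ≠ v) (hu' : u' ≠ v), (G.deleteVertex v).IsPath ⟨u, hu⟩ w ⟨u', hu'⟩ := by
  induction h with
  | nil u =>
    rcases eq_or_ne u v with rfl | hu
    · exact .inl ⟨[], [], .nil u, .nil u⟩
    · exact .inr ⟨hu, hu, .nil _⟩
  | @cons e w u' h ih =>
    rcases ih with ⟨w₁, w₂, h₁, h₂⟩ | ⟨hterm, hu', hpath⟩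
    · exact .inl ⟨_, w₂, h₁.cons e, h₂⟩
    · rcases eq_or_ne (G.init e) v with rfl | hinit
      · exact .inl ⟨[], _, .nil _, h.cons e⟩
      · exact .inr ⟨hinit, hu', hpath.cons (G := G.deleteVertex v) ⟨e, hinit, hterm⟩⟩

theorem soficShift_deleteVertex_subset (G : LabelledGraph V E A) (v : V) :
    (G.deleteVertex v).soficShift ⊆ G.soficShift := by
  rintro _ ⟨p, hp, rfl⟩
  exact ⟨fun k => (p k).1, fun k => congrArg Subtype.val (hp k), rfl⟩

/-- Otherwise `G` without `v` would still present `X`. -/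
theorem IsMinimalRightResolvingPresentation.exists_word_forall_isPath_visits [Finite V] [Finite E]
    (hG : G.IsMinimalRightResolvingPresentation X) (v : V) :
    ∃ w ∈ words X, ∀ u u', G.IsPath u w u' → ∃ w₁ w₂, G.IsPath u w₁ v ∧ G.IsPath v w₂ u' := by
  by_contra! hcon
  have hwords : words X ⊆ (G.deleteVertex v).language := by
    intro w hw
    obtain ⟨u, u', hpath, havoid⟩ := hcon w hw
    rcases hpath.visits_or_isPath_deleteVertex v with ⟨w₁, w₂, h₁, h₂⟩ | ⟨hu, hu', hpath'⟩
    · exact absurd h₂ (havoid w₁ w₂ h₁)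
    · exact mem_language_iff.2 ⟨_, _, hpath'⟩
  have hRR : (G.deleteVertex v).IsRightResolving := fun e e' hinit hlabel =>
    Subtype.ext (hG.rightResolving _ _ (congrArg Subtype.val hinit) hlabel)
  have hpresents : (G.deleteVertex v).soficShift = X := by
    refine ((G.soficShift_deleteVertex_subset v).trans hG.presents.subset).antisymm fun x hx => ?_
    exact mem_soficShift_iff.2 fun k n =>
      hwords (mem_words_iff_exists_window.2 ⟨x, hx, k, n, rfl⟩)
  exact (hG.card_le hRR hpresents).not_gt (Finite.card_subtype_lt (x := v) (by simp))

theorem IsMinimalRightResolvingPresentation.isIrreducible [Finite V] [Finite E]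
    (hG : G.IsMinimalRightResolvingPresentation X) (hX : IsIrreducibleShift X) :
    G.IsIrreducible := by
  suffices exists_path : ∀ v v', ∃ w, G.IsPath v w v' by
    intro v v'
    obtain ⟨e, rfl⟩ := (hG.essential v).2
    obtain ⟨w, hw⟩ := exists_path (G.term e) v'
    exact ⟨_, List.cons_ne_nil _ _, hw.cons e⟩
  intro v v'
  obtain ⟨w, hw, hvisit⟩ := hG.exists_word_forall_isPath_visits v
  obtain ⟨w', hw', hvisit'⟩ := hG.exists_word_forall_isPath_visits v'
  obtain ⟨z, hz⟩ : ∃ z, w ++ (z ++ w') ∈ words X := by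
    rcases hX w hw w' hw' with h | ⟨z, -, h⟩
    · exact ⟨[], h⟩
    · exact ⟨z, by rwa [← List.append_assoc]⟩
  rw [← hG.presents] at hz
  obtain ⟨u, u', hpath⟩ := mem_language_iff.1 (words_soficShift_subset_language hz)
  obtain ⟨m, hw, hpath⟩ := isPath_append_iff.1 hpath
  obtain ⟨m', hz, hw'⟩ := isPath_append_iff.1 hpath
  obtain ⟨-, w₂, -, h₂⟩ := hvisit u m hw
  obtain ⟨w₁, -, h₁, -⟩ := hvisit' m' u' hw'
  exact ⟨w₂ ++ (z ++ w₁), isPath_append_iff.2 ⟨m, h₂, isPath_append_iff.2 ⟨m', hz, h₁⟩⟩⟩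

theorem IsRightResolving.followerSetGraph (hG : G.IsRightResolving) :
    G.followerSetGraph.IsRightResolving := by
  rintro ⟨_, e, rfl⟩ ⟨_, e', rfl⟩ hinit hlabel
  have hinit : G.followerSet (G.init e) = G.followerSet (G.init e') := congrArg Subtype.val hinit
  have hlabel : G.label e = G.label e' := hlabel
  have hterm : G.followerSet (G.term e) = G.followerSet (G.term e') := by
    ext w
    rw [← hG.cons_mem_followerSet_init_iff, ← hG.cons_mem_followerSet_init_iff, hinit, hlabel]
  simp only [hinit, hlabel, hterm]

theorem IsRightResolving.followerSet_followerSetGraph (hG : G.IsRightResolving)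
    (F : Set.range G.followerSet) : G.followerSetGraph.followerSet F = F := by
  obtain ⟨_, v, rfl⟩ := F
  ext w
  induction w generalizing v with
  | nil => exact iff_of_true (nil_mem_followerSet _) (nil_mem_followerSet _)
  | cons a w ih =>
    rw [cons_mem_followerSet_iff]
    constructor
    · rintro ⟨⟨_, e, rfl⟩, hinit, rfl, hw⟩
      have hinit : G.followerSet (G.init e) = G.followerSet v := congrArg Subtype.val hinit
      change _ ∈ G.followerSet v
      rw [← hinit]
      exact (hG.cons_mem_followerSet_init_iff e).2 ((ih (G.term e)).1 hw)
    · intro h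
      obtain ⟨e, rfl, rfl, hw⟩ := cons_mem_followerSet_iff.1 h
      exact ⟨⟨_, e, rfl⟩, rfl, rfl, (ih (G.term e)).2 hw⟩

theorem IsRightResolving.soficShift_followerSetGraph [Finite E] (hG : G.IsRightResolving) :
    G.followerSetGraph.soficShift = G.soficShift := by
  have hlanguage : G.followerSetGraph.language = G.language := by
    simp only [language, hG.followerSet_followerSetGraph]
    exact Set.iUnion_coe_set _ _ |>.trans Set.biUnion_range
  ext x
  rw [mem_soficShift_iff, mem_soficShift_iff, hlanguage]

theorem IsMinimalRightResolvingPresentation.injective_followerSet [Finite V] [Finite E]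
    (hG : G.IsMinimalRightResolvingPresentation X) : Function.Injective G.followerSet := by
  have hle := hG.card_le hG.rightResolving.followerSetGraph
    (hG.rightResolving.soficShift_followerSetGraph.trans hG.presents)
  exact Set.rangeFactorization_injective.1
    (Set.rangeFactorization_surjective.bijective_of_nat_card_le hle).1

end Minimality

end LabelledGraph

section PerronFrobenius

variable {n : Type*} [Fintype n] {M : Matrix n n ℝ}

/-- The Collatz–Wielandt set of `M`: the rates `c` at which some nonzero nonnegative vector grows
under `M`. For an irreducible matrix its maximum is the Perron eigenvalue. -/
def collatzWielandtSet (M : Matrix n n ℝ) : Set ℝ :=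
  {c | ∃ x : n → ℝ, 0 < x ∧ c • x ≤ M *ᵥ x}

theorem mem_collatzWielandtSet_iff_exists_stdSimplex {c : ℝ} :
    c ∈ collatzWielandtSet M ↔ ∃ x ∈ stdSimplex ℝ n, c • x ≤ M *ᵥ x := by
  constructor
  · rintro ⟨x, hx, hcx⟩
    have hsum : 0 < ∑ i, x i := Fintype.sum_pos hx
    refine ⟨(∑ i, x i)⁻¹ • x, ⟨fun i => mul_nonneg (inv_nonneg.2 hsum.le) (hx.le i), ?_⟩, ?_⟩
    · simp only [Pi.smul_apply, smul_eq_mul, ← Finset.mul_sum, inv_mul_cancel₀ hsum.ne']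
    · rw [mulVec_smul, smul_comm]
      exact smul_le_smul_of_nonneg_left hcx (inv_nonneg.2 hsum.le)
  · rintro ⟨x, ⟨hx, hsum⟩, hcx⟩
    refine ⟨x, lt_of_le_of_ne hx ?_, hcx⟩
    rintro rfl
    simp at hsum

theorem le_sum_of_mem_collatzWielandtSet (hM : ∀ i j, 0 ≤ M i j) {c : ℝ}
    (hc : c ∈ collatzWielandtSet M) : c ≤ ∑ i, ∑ j, M i j := by
  obtain ⟨x, hx, hcx⟩ := mem_collatzWielandtSet_iff_exists_stdSimplex.1 hc
  calc c = ∑ i, c * x i := by rw [← Finset.mul_sum, hx.2, mul_one]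
    _ ≤ ∑ i, ∑ j, M i j * x j := Finset.sum_le_sum fun i _ => hcx i
    _ ≤ ∑ i, ∑ j, M i j := Finset.sum_le_sum fun i _ => Finset.sum_le_sum fun j _ =>
        mul_le_of_le_one_right (hM i j) (mem_Icc_of_mem_stdSimplex hx j).2

theorem exists_isGreatest_collatzWielandtSet [Nonempty n] (hM : ∀ i j, 0 ≤ M i j) :
    ∃ c, IsGreatest (collatzWielandtSet M) c := by
  classical
  let K : Set (ℝ × (n → ℝ)) :=
    (Set.Icc 0 (∑ i, ∑ j, M i j) ×ˢ stdSimplex ℝ n) ∩ {p | p.1 • p.2 ≤ M *ᵥ p.2}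
  have hK : IsCompact K := (isCompact_Icc.prod (isCompact_stdSimplex ℝ n)).inter_right <|
    isClosed_le (by fun_prop) (by fun_prop)
  have mem_image {c : ℝ} (hc0 : 0 ≤ c) (hc : c ∈ collatzWielandtSet M) : c ∈ Prod.fst '' K := by
    obtain ⟨x, hx, hcx⟩ := mem_collatzWielandtSet_iff_exists_stdSimplex.1 hc
    exact ⟨(c, x), ⟨⟨⟨hc0, le_sum_of_mem_collatzWielandtSet hM hc⟩, hx⟩, hcx⟩, rfl⟩
  have zero_mem : (0 : ℝ) ∈ collatzWielandtSet M := by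
    refine ⟨1, zero_lt_one, ?_⟩
    rw [zero_smul]
    exact fun i => Finset.sum_nonneg fun j _ => mul_nonneg (hM i j) zero_le_one
  obtain ⟨_, ⟨⟨c, x⟩, ⟨⟨⟨hc0, -⟩, hx⟩, hcx⟩, rfl⟩, hmax⟩ :=
    (hK.image continuous_fst).exists_isGreatest ⟨0, mem_image le_rfl zero_mem⟩
  refine ⟨c, mem_collatzWielandtSet_iff_exists_stdSimplex.2 ⟨x, hx, hcx⟩, fun d hd => ?_⟩
  rcases le_total 0 d with hd0 | hd0
  · exact hmax (mem_image hd0 hd)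
  · exact hd0.trans hc0

theorem exists_lt_mem_collatzWielandtSet [Nonempty n] {c : ℝ} {y : n → ℝ} (hy : ∀ i, 0 < y i)
    (h : ∀ i, c * y i < (M *ᵥ y) i) : ∃ d ∈ collatzWielandtSet M, c < d := by
  obtain ⟨i₀, hi₀⟩ := Finite.exists_min fun i => (M *ᵥ y) i / y i
  refine ⟨(M *ᵥ y) i₀ / y i₀, ⟨y, ?_, fun i => (le_div_iff₀ (hy i)).1 (hi₀ i)⟩,
    (lt_div_iff₀ (hy i₀)).2 (h i₀)⟩
  exact Pi.lt_def.2 ⟨fun i => (hy i).le, i₀, hy i₀⟩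

theorem mulVec_pos_of_pos (hM : ∀ i j, 0 < M i j) {x : n → ℝ} (hx : 0 < x) (i : n) :
    0 < (M *ᵥ x) i := by
  obtain ⟨hx0, j, hj⟩ := Pi.lt_def.1 hx
  exact Finset.sum_pos' (fun j _ => mul_nonneg (hM i j).le (hx0 j))
    ⟨j, Finset.mem_univ j, mul_pos (hM i j) hj⟩

theorem exists_commute_pos_of_isIrreducible (hM : M.IsIrreducible) :
    ∃ Q : Matrix n n ℝ, Commute Q M ∧ ∀ i j, 0 < Q i j := by
  classical
  choose k _ hk using (isIrreducible_iff_exists_pow_pos hM.nonneg).1 hM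
  refine ⟨∑ i, ∑ j, M ^ k i j, ?_, fun i j => ?_⟩
  · exact .sum_left _ _ _ fun i _ => .sum_left _ _ _ fun j _ => (Commute.refl M).pow_left _
  · have hnonneg (i' j' : n) : 0 ≤ (M ^ k i' j') i j := pow_apply_nonneg hM.nonneg _ i j
    simp only [Matrix.sum_apply]
    exact Finset.sum_pos' (fun i' _ => Finset.sum_nonneg fun j' _ => hnonneg i' j')
      ⟨i, Finset.mem_univ i, Finset.sum_pos' (fun j' _ => hnonneg i j')
        ⟨j, Finset.mem_univ j, hk i j⟩⟩

/-- If `c` is the maximum of the Collatz–Wielandt set, attained at `x`, and `M *ᵥ x ≠ c • x`, then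
applying a positive matrix that commutes with `M` makes the inequality strict everywhere, so that
`c` can be increased. -/
theorem exists_pos_mulVec_eq_smul_of_isIrreducible [Nonempty n] (hM : M.IsIrreducible) :
    ∃ (c : ℝ) (x : n → ℝ), (∀ i, 0 < x i) ∧ M *ᵥ x = c • x := by
  obtain ⟨Q, hQM, hQ⟩ := exists_commute_pos_of_isIrreducible hM
  obtain ⟨c, ⟨x, hx, hcx⟩, hmax⟩ := exists_isGreatest_collatzWielandtSet hM.nonneg
  have hcomm : M *ᵥ (Q *ᵥ x) = Q *ᵥ (M *ᵥ x) := by rw [mulVec_mulVec, mulVec_mulVec, hQM.eq]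
  refine ⟨c, Q *ᵥ x, mulVec_pos_of_pos hQ hx, ?_⟩
  suffices hMx : M *ᵥ x = c • x by rw [hcomm, hMx, mulVec_smul]
  by_contra hne
  have hstrict (i : n) : c * (Q *ᵥ x) i < (M *ᵥ (Q *ᵥ x)) i := by
    have hpos := mulVec_pos_of_pos hQ (sub_pos.2 (lt_of_le_of_ne hcx (Ne.symm hne))) i
    rwa [mulVec_sub, mulVec_smul, ← hcomm, Pi.sub_apply, sub_pos] at hpos
  obtain ⟨d, hd, hcd⟩ := exists_lt_mem_collatzWielandtSet (mulVec_pos_of_pos hQ hx) hstrict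
  exact (hmax hd).not_gt hcd

variable [DecidableEq n]

theorem ofReal_le_spectralRadius_of_mulVec_eq_smul {c : ℝ} {x : n → ℝ} (hx : x ≠ 0)
    (h : M *ᵥ x = c • x) :
    ENNReal.ofReal c ≤ spectralRadius ℂ (M.map Complex.ofRealHom) := by
  have hc : (c : ℂ) ∈ spectrum ℂ (M.map Complex.ofRealHom) := by
    rw [← spectrum_toLin', ← Module.End.hasEigenvalue_iff_mem_spectrum]
    refine Module.End.hasEigenvalue_of_hasEigenvector (x := Complex.ofRealHom ∘ x)
      ⟨Module.End.mem_eigenspace_iff.2 ?_, fun h0 => hx ?_⟩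
    · ext i
      have hi := congrFun h i
      rw [toLin'_apply, ← RingHom.map_mulVec, hi]
      simp
    · exact funext fun i => Complex.ofReal_injective (congrFun h0 i)
  calc ENNReal.ofReal c ≤ ENNReal.ofReal ‖(c : ℂ)‖ :=
        ENNReal.ofReal_le_ofReal (Complex.norm_real c ▸ le_abs_self c)
    _ = ‖(c : ℂ)‖₊ := ofReal_norm _
    _ ≤ spectralRadius ℂ (M.map Complex.ofRealHom) := le_iSup₂ (α := ENNReal) (c : ℂ) hc

section

attribute [local instance] Matrix.linftyOpNormedRing Matrix.linftyOpNormedAlgebra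

theorem exists_eigenvector_nnnorm_eq_spectralRadius [Nonempty n] (B : Matrix n n ℂ) :
    ∃ (z : ℂ) (x : n → ℂ), x ≠ 0 ∧ B *ᵥ x = z • x ∧ ‖z‖₊ = spectralRadius ℂ B := by
  obtain ⟨z, hz, hρ⟩ := spectrum.exists_nnnorm_eq_spectralRadius B
  rw [← spectrum_toLin', ← Module.End.hasEigenvalue_iff_mem_spectrum] at hz
  obtain ⟨x, hx⟩ := hz.exists_hasEigenvector
  exact ⟨z, x, hx.2, hx.apply_eq_smul, hρ⟩

end

/-- Maximum principle: for an eigenvector `x` of an eigenvalue of largest modulus, take `T` to be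
the set where `‖x s‖ / f s` is maximal. -/
theorem exists_closed_harmonic_set [Nonempty n] (hM : ∀ i j, 0 ≤ M i j) {f : n → ℝ}
    (hf : ∀ i, 0 < f i) {c : ℝ} (hMf : ∀ i, (M *ᵥ f) i ≤ c * f i)
    (hc : ENNReal.ofReal c ≤ spectralRadius ℂ (M.map Complex.ofRealHom)) :
    ∃ T : Set n, T.Nonempty ∧ ∀ s ∈ T, (M *ᵥ f) s = c * f s ∧ ∀ t, M s t ≠ 0 → t ∈ T := by
  obtain ⟨z, x, hx, hzx, hz⟩ :=
    exists_eigenvector_nnnorm_eq_spectralRadius (M.map Complex.ofRealHom)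
  have hcz : c ≤ ‖z‖ := by
    rw [← hz] at hc
    exact ENNReal.ofReal_le_coe.1 hc
  obtain ⟨s₀, hs₀⟩ := Finite.exists_max fun s => ‖x s‖ / f s
  set m := ‖x s₀‖ / f s₀
  have hxm (s : n) : ‖x s‖ ≤ m * f s := (div_le_iff₀ (hf s)).1 (hs₀ s)
  have hm0 : 0 < m := by
    obtain ⟨s, hs⟩ := Function.ne_iff.1 hx
    exact (div_pos (norm_pos_iff.2 hs) (hf s)).trans_le (hs₀ s)
  refine ⟨{s | ‖x s‖ = m * f s}, ⟨s₀, (div_mul_cancel₀ _ (hf s₀).ne').symm⟩, fun s hs => ?_⟩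
  have hterm (t : n) (_ : t ∈ Finset.univ) : M s t * ‖x t‖ ≤ M s t * (m * f t) :=
    mul_le_mul_of_nonneg_left (hxm t) (hM s t)
  have hlower : m * (c * f s) ≤ ∑ t, M s t * ‖x t‖ :=
    calc m * (c * f s) = c * ‖x s‖ := by rw [show ‖x s‖ = m * f s from hs, mul_left_comm]
      _ ≤ ‖z‖ * ‖x s‖ := mul_le_mul_of_nonneg_right hcz (norm_nonneg _)
      _ = ‖∑ t, (M s t : ℂ) * x t‖ := by
        rw [← norm_mul, ← smul_eq_mul, ← Pi.smul_apply, ← hzx]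
        rfl
      _ ≤ ∑ t, M s t * ‖x t‖ := (norm_sum_le _ _).trans_eq <| Finset.sum_congr rfl fun t _ => by
        rw [norm_mul, Complex.norm_of_nonneg (hM s t)]
  have hmiddle : ∑ t, M s t * ‖x t‖ ≤ ∑ t, M s t * (m * f t) := Finset.sum_le_sum hterm
  have hupper : ∑ t, M s t * (m * f t) = m * (M *ᵥ f) s := by
    simp only [mulVec, dotProduct, Finset.mul_sum, mul_left_comm]
  have hbound : m * (M *ᵥ f) s ≤ m * (c * f s) := mul_le_mul_of_nonneg_left (hMf s) hm0.le
  refine ⟨mul_left_cancel₀ hm0.ne' (by linarith), fun t ht => ?_⟩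
  have heq := (Finset.sum_eq_sum_iff_of_le hterm).1 (by linarith) t (Finset.mem_univ t)
  exact mul_left_cancel₀ ht heq

end PerronFrobenius

namespace LabelledGraph

section AdjacencyMatrix

variable {V E A : Type*} {G : LabelledGraph V E A}

/-- The adjacency matrix with real entries, to which the theory of nonnegative matrices applies. -/
noncomputable def realAdjMatrix (G : LabelledGraph V E A) : Matrix V V ℝ :=
  Matrix.of fun u v => (Nat.card {e : E // G.init e = u ∧ G.term e = v} : ℝ)

theorem map_realAdjMatrix (G : LabelledGraph V E A) :
    G.realAdjMatrix.map Complex.ofRealHom = G.adjMatrix := by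
  ext u v
  simp [realAdjMatrix, adjMatrix]

theorem realAdjMatrix_nonneg (G : LabelledGraph V E A) (u v : V) : 0 ≤ G.realAdjMatrix u v :=
  Nat.cast_nonneg _

theorem realAdjMatrix_pos [Finite E] (G : LabelledGraph V E A) (e : E) :
    0 < G.realAdjMatrix (G.init e) (G.term e) := by
  have : Nonempty {e' : E // G.init e' = G.init e ∧ G.term e' = G.term e} := ⟨⟨e, rfl, rfl⟩⟩
  exact Nat.cast_pos.2 Nat.card_pos

theorem IsPath.realAdjMatrix_pow_pos [Fintype V] [DecidableEq V] [Finite E] {u v : V} {w : List A}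
    (h : G.IsPath u w v) : 0 < (G.realAdjMatrix ^ w.length) u v := by
  induction h with
  | nil v => simp
  | @cons e w v _ ih =>
    rw [List.length_cons, pow_succ', mul_apply]
    exact Finset.sum_pos' (fun m _ => mul_nonneg (G.realAdjMatrix_nonneg _ m)
      (pow_apply_nonneg G.realAdjMatrix_nonneg _ m v))
      ⟨G.term e, Finset.mem_univ _, mul_pos (G.realAdjMatrix_pos e) ih⟩

theorem IsIrreducible.realAdjMatrix [Finite V] [Finite E] (hG : G.IsIrreducible) :
    G.realAdjMatrix.IsIrreducible := by
  classical
  have := Fintype.ofFinite V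
  refine (isIrreducible_iff_exists_pow_pos G.realAdjMatrix_nonneg).2 fun u v => ?_
  obtain ⟨w, hw, hpath⟩ := hG u v
  exact ⟨w.length, List.length_pos_iff.2 hw, hpath.realAdjMatrix_pow_pos⟩

theorem realAdjMatrix_mulVec [Fintype V] [DecidableEq V] [Fintype E] (G : LabelledGraph V E A)
    (f : V → ℝ) (v : V) : (G.realAdjMatrix *ᵥ f) v = ∑ e with G.init e = v, f (G.term e) := by
  rw [← Finset.sum_fiberwise' _ G.term f]
  refine Finset.sum_congr rfl fun u _ => ?_
  rw [Finset.sum_const, nsmul_eq_mul, Finset.filter_filter]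
  simp [LabelledGraph.realAdjMatrix, Nat.card_eq_fintype_card, Fintype.card_subtype]

end AdjacencyMatrix

section SubsetEdges

variable {V E A : Type*} {G : LabelledGraph V E A} {j : ℕ} {s t : Subsets V j} {a : A}

theorem exists_edge_of_next_eq_some {v u : V} (h : G.next v a = some u) :
    ∃ e, G.init e = v ∧ G.label e = a ∧ G.term e = u := by
  unfold next at h
  split_ifs at h with he
  exact ⟨he.choose, he.choose_spec.1, he.choose_spec.2, Option.some.inj h⟩

theorem IsRightResolving.next_init_label (hG : G.IsRightResolving) (e : E) :
    G.next (G.init e) (G.label e) = some (G.term e) := by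
  have he : ∃ e', G.init e' = G.init e ∧ G.label e' = G.label e := ⟨e, rfl, rfl⟩
  rw [next, dif_pos he, hG _ e he.choose_spec.1 he.choose_spec.2]

theorem IsSubsetEdge.exists_edge (h : G.IsSubsetEdge s a t) {v : V} (hv : v ∈ s.1) :
    ∃ e, G.init e = v ∧ G.label e = a ∧ G.term e ∈ t.1 := by
  obtain ⟨u, hu, hnext⟩ := h.1 v hv
  obtain ⟨e, hinit, hlabel, rfl⟩ := exists_edge_of_next_eq_some hnext
  exact ⟨e, hinit, hlabel, hu⟩

theorem IsSubsetEdge.mem_iff (h : G.IsSubsetEdge s a t) {u : V} :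
    u ∈ t.1 ↔ ∃ v ∈ s.1, G.next v a = some u := by
  classical
  have himage : s.1.image (G.next · a) = t.1.image some := by
    apply Finset.eq_of_subset_of_card_le
    · intro x hx
      obtain ⟨v, hv, rfl⟩ := Finset.mem_image.1 hx
      obtain ⟨u, hu, hnext⟩ := h.1 v hv
      exact Finset.mem_image.2 ⟨u, hu, hnext.symm⟩
    · rw [Finset.card_image_of_injOn fun v hv v' hv' => h.2 v hv v' hv', s.2]
      exact Finset.card_image_le.trans_eq t.2
  simpa using (Finset.ext_iff.1 himage (some u)).symm

theorem IsSubsetEdge.unique {t' : Subsets V j} (h : G.IsSubsetEdge s a t)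
    (h' : G.IsSubsetEdge s a t') : t = t' :=
  Subtype.ext <| Finset.ext fun _ => h.mem_iff.trans h'.mem_iff.symm

theorem IsRightResolving.term_mem_of_isSubsetEdge (hG : G.IsRightResolving) {e : E}
    (h : G.IsSubsetEdge s (G.label e) t) (he : G.init e ∈ s.1) : G.term e ∈ t.1 :=
  h.mem_iff.2 ⟨_, he, hG.next_init_label e⟩

/-- A word that can be read from `v` can be read along subsets in `T`, hence from every vertex of
the starting subset. -/
theorem IsRightResolving.followerSet_subset_of_closed (hG : G.IsRightResolving)
    {T : Set (Subsets V j)} (hT : ∀ s ∈ T, ∀ e, G.init e ∈ s.1 →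
      ∃ t ∈ T, G.IsSubsetEdge s (G.label e) t) {s : Subsets V j} (hs : s ∈ T) {v v' : V}
    (hv : v ∈ s.1) (hv' : v' ∈ s.1) : G.followerSet v ⊆ G.followerSet v' := by
  intro w
  induction w generalizing s v v' with
  | nil => exact fun _ => nil_mem_followerSet v'
  | cons a w ih =>
    intro haw
    obtain ⟨e, rfl, rfl, hw⟩ := cons_mem_followerSet_iff.1 haw
    obtain ⟨t, ht, hst⟩ := hT s hs e hv
    obtain ⟨e', hinit, hlabel, hterm⟩ := hst.exists_edge hv'
    exact cons_mem_followerSet_iff.2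
      ⟨e', hinit, hlabel, ih ht (hG.term_mem_of_isSubsetEdge hst hv) hterm hw⟩

theorem finite_subsetEdges [Finite V] [Finite E] (hj : j ≠ 0) : Finite (G.SubsetEdges j) := by
  have label_mem (δ : G.SubsetEdges j) : δ.1.2.1 ∈ Set.range G.label := by
    obtain ⟨v, hv⟩ := Finset.card_pos.1 (δ.1.1.2.symm ▸ Nat.pos_of_ne_zero hj)
    obtain ⟨e, -, hlabel, -⟩ := δ.2.exists_edge hv
    exact ⟨e, hlabel⟩
  refine Finite.of_injective (β := Subsets V j × Set.range G.label × Subsets V j)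
    (fun δ => (δ.1.1, ⟨δ.1.2.1, label_mem δ⟩, δ.1.2.2)) fun δ δ' h => Subtype.ext ?_
  simp only [Prod.mk.injEq, Subtype.mk.injEq] at h
  exact Prod.ext h.1 (Prod.ext h.2.1 h.2.2)

variable [Fintype E]

open scoped Classical in
/-- The edges of `G` with label `a` that leave a vertex of `s`. -/
noncomputable def edgesFrom (G : LabelledGraph V E A) (s : Finset V) (a : A) : Finset E :=
  {e | G.init e ∈ s ∧ G.label e = a}

open scoped Classical in
/-- The edges of `G` leaving a vertex of `s` that extend to an edge of the subset graph. -/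
noncomputable def liftableEdges (G : LabelledGraph V E A) (s : Subsets V j) : Finset E :=
  {e | G.init e ∈ s.1 ∧ ∃ t, G.IsSubsetEdge s (G.label e) t}

theorem mem_edgesFrom {s : Finset V} {e : E} :
    e ∈ G.edgesFrom s a ↔ G.init e ∈ s ∧ G.label e = a := by
  simp [edgesFrom]

theorem mem_liftableEdges {e : E} :
    e ∈ G.liftableEdges s ↔ G.init e ∈ s.1 ∧ ∃ t, G.IsSubsetEdge s (G.label e) t := by
  simp [liftableEdges]

theorem IsRightResolving.injOn_term_edgesFrom (hG : G.IsRightResolving)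
    (h : G.IsSubsetEdge s a t) : Set.InjOn G.term (G.edgesFrom s.1 a) := by
  intro e he e' he' hterm
  obtain ⟨hinit, rfl⟩ := mem_edgesFrom.1 he
  obtain ⟨hinit', hlabel⟩ := mem_edgesFrom.1 he'
  refine hG e e' (h.2 _ hinit _ hinit' ?_) hlabel.symm
  rw [hG.next_init_label, ← hlabel, hG.next_init_label, hterm]

theorem IsRightResolving.image_term_edgesFrom [DecidableEq V] (hG : G.IsRightResolving)
    (h : G.IsSubsetEdge s a t) : (G.edgesFrom s.1 a).image G.term = t.1 := by
  ext u
  simp only [h.mem_iff, Finset.mem_image, mem_edgesFrom]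
  constructor
  · rintro ⟨e, ⟨hinit, rfl⟩, rfl⟩
    exact ⟨_, hinit, hG.next_init_label e⟩
  · rintro ⟨_, hv, hnext⟩
    obtain ⟨e, rfl, hlabel, hterm⟩ := exists_edge_of_next_eq_some hnext
    exact ⟨e, ⟨hv, hlabel⟩, hterm⟩

end SubsetEdges

section SubsetWeight

variable {V E A : Type*} {G : LabelledGraph V E A} {j : ℕ} {s : Subsets V j} {r : V → ℝ}

/-- The total weight of the vertices of `s`, the test vector on the vertices of the subset graph
induced by a vector on the vertices of `G`. -/
def subsetWeight (r : V → ℝ) (s : Subsets V j) : ℝ :=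
  ∑ v ∈ s.1, r v

theorem subsetWeight_pos (hj : j ≠ 0) (hr : ∀ v, 0 < r v) (s : Subsets V j) :
    0 < subsetWeight r s :=
  Finset.sum_pos (fun v _ => hr v) (Finset.card_pos.1 (s.2.symm ▸ Nat.pos_of_ne_zero hj))

theorem subsetWeight_smul (c : ℝ) (r : V → ℝ) (s : Subsets V j) :
    subsetWeight (c • r) s = c * subsetWeight r s :=
  (Finset.mul_sum _ _ _).symm

variable [Fintype E]

theorem IsRightResolving.subsetWeight_eq_sum_edgesFrom (hG : G.IsRightResolving)
    {t : Subsets V j} {a : A} (h : G.IsSubsetEdge s a t) (r : V → ℝ) :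
    subsetWeight r t = ∑ e ∈ G.edgesFrom s.1 a, r (G.term e) := by
  classical
  rw [subsetWeight, ← hG.image_term_edgesFrom h, Finset.sum_image (hG.injOn_term_edgesFrom h)]

theorem IsRightResolving.realAdjMatrix_mulVec_subsetWeight [Fintype V] [LinearOrder V]
    [Finite (G.SubsetEdges j)] (hG : G.IsRightResolving) (r : V → ℝ) (s : Subsets V j) :
    ((G.positiveSubsetGraph j).realAdjMatrix *ᵥ subsetWeight r) s =
      ∑ e ∈ G.liftableEdges s, r (G.term e) := by
  classical
  have := Fintype.ofFinite (G.SubsetEdges j)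
  have hdisjoint : Set.PairwiseDisjoint {δ : G.SubsetEdges j | δ.1.1 = s}
      fun δ => G.edgesFrom δ.1.1.1 δ.1.2.1 := by
    rintro ⟨⟨s, a, t⟩, h⟩ rfl ⟨⟨s, a', t'⟩, h'⟩ rfl hne
    refine Finset.disjoint_left.2 fun e he he' => hne ?_
    obtain rfl : a = a' := (mem_edgesFrom.1 he).2.symm.trans (mem_edgesFrom.1 he').2
    exact Subtype.ext (congrArg (s, a, ·) (h.unique h'))
  calc _ = ∑ δ : G.SubsetEdges j with δ.1.1 = s, subsetWeight r δ.1.2.2 :=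
        realAdjMatrix_mulVec _ _ _
    _ = ∑ δ : G.SubsetEdges j with δ.1.1 = s,
        ∑ e ∈ G.edgesFrom δ.1.1.1 δ.1.2.1, r (G.term e) :=
      Finset.sum_congr rfl fun δ _ => hG.subsetWeight_eq_sum_edgesFrom δ.2 r
    _ = ∑ e ∈ G.liftableEdges s, r (G.term e) := by
      rw [← Finset.sum_biUnion (by simpa using hdisjoint)]
      refine Finset.sum_congr (Finset.ext fun e => ?_) fun _ _ => rfl
      simp only [Finset.mem_biUnion, Finset.mem_filter, Finset.mem_univ, true_and, mem_edgesFrom,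
        mem_liftableEdges]
      constructor
      · rintro ⟨⟨⟨s, _, t⟩, h⟩, rfl, hinit, rfl⟩
        exact ⟨hinit, t, h⟩
      · rintro ⟨hinit, t, h⟩
        exact ⟨⟨(s, _, t), h⟩, rfl, hinit, rfl⟩

theorem subsetWeight_realAdjMatrix_mulVec [Fintype V] [DecidableEq V] (G : LabelledGraph V E A)
    (r : V → ℝ) (s : Subsets V j) :
    subsetWeight (G.realAdjMatrix *ᵥ r) s = ∑ e with G.init e ∈ s.1, r (G.term e) := by
  simp only [subsetWeight, realAdjMatrix_mulVec]
  exact Finset.sum_fiberwise_eq_sum_filter _ _ _ _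

theorem liftableEdges_subset [DecidableEq V] (G : LabelledGraph V E A) (s : Subsets V j) :
    G.liftableEdges s ⊆ ({e | G.init e ∈ s.1} : Finset E) := fun e he => by
  simpa using (mem_liftableEdges.1 he).1

end SubsetWeight

section SpectralGap

variable {V E A : Type*} {G : LabelledGraph V E A} {j : ℕ} {s : Subsets V j} {r : V → ℝ}
  [Fintype V] [LinearOrder V] [Finite E] [Finite (G.SubsetEdges j)]

theorem IsRightResolving.realAdjMatrix_mulVec_subsetWeight_le (hG : G.IsRightResolving)
    (hr : ∀ v, 0 ≤ r v) (s : Subsets V j) :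
    ((G.positiveSubsetGraph j).realAdjMatrix *ᵥ subsetWeight r) s ≤
      subsetWeight (G.realAdjMatrix *ᵥ r) s := by
  have := Fintype.ofFinite E
  rw [hG.realAdjMatrix_mulVec_subsetWeight, subsetWeight_realAdjMatrix_mulVec]
  exact Finset.sum_le_sum_of_subset_of_nonneg (G.liftableEdges_subset s) fun e _ _ => hr _

theorem IsRightResolving.exists_isSubsetEdge_of_mulVec_subsetWeight_eq (hG : G.IsRightResolving)
    (hr : ∀ v, 0 < r v) (h : ((G.positiveSubsetGraph j).realAdjMatrix *ᵥ subsetWeight r) s =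
      subsetWeight (G.realAdjMatrix *ᵥ r) s) {e : E} (he : G.init e ∈ s.1) :
    ∃ t, G.IsSubsetEdge s (G.label e) t := by
  have := Fintype.ofFinite E
  rw [hG.realAdjMatrix_mulVec_subsetWeight, subsetWeight_realAdjMatrix_mulVec] at h
  by_contra hlift
  refine h.not_lt (Finset.sum_lt_sum_of_subset (G.liftableEdges_subset s) (i := e) (by simpa)
    (fun hmem => hlift (mem_liftableEdges.1 hmem).2) (hr _) fun e _ _ => (hr _).le)

theorem IsRightResolving.exists_closed_subsets [Nonempty (Subsets V j)] (hG : G.IsRightResolving)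
    (hj : j ≠ 0) (hr : ∀ v, 0 < r v) {c : ℝ} (hcr : G.realAdjMatrix *ᵥ r ≤ c • r)
    (hc : ENNReal.ofReal c ≤ spectralRadius ℂ (G.positiveSubsetGraph j).adjMatrix) :
    ∃ T : Set (Subsets V j), T.Nonempty ∧ ∀ s ∈ T, ∀ e, G.init e ∈ s.1 →
      ∃ t ∈ T, G.IsSubsetEdge s (G.label e) t := by
  have hle (s : Subsets V j) :=
    hG.realAdjMatrix_mulVec_subsetWeight_le (fun v => (hr v).le) s
  have hle' (s : Subsets V j) : subsetWeight (G.realAdjMatrix *ᵥ r) s ≤ c * subsetWeight r s :=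
    (Finset.sum_le_sum fun v _ => hcr v).trans_eq (subsetWeight_smul c r s)
  rw [← map_realAdjMatrix] at hc
  obtain ⟨T, hTne, hT⟩ := exists_closed_harmonic_set (realAdjMatrix_nonneg _)
    (subsetWeight_pos hj hr) (fun s => (hle s).trans (hle' s)) hc
  refine ⟨T, hTne, fun s hs e he => ?_⟩
  obtain ⟨hharmonic, hclosed⟩ := hT s hs
  obtain ⟨t, ht⟩ := hG.exists_isSubsetEdge_of_mulVec_subsetWeight_eq hr
    ((hle s).antisymm (hharmonic ▸ hle' s)) he
  exact ⟨t, hclosed t ((G.positiveSubsetGraph j).realAdjMatrix_pos ⟨(s, _, t), ht⟩).ne', ht⟩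

end SpectralGap

end LabelledGraph

open LabelledGraph in
theorem mainTheorem2_general {V E A : Type*} [Fintype V] [LinearOrder V] [Finite E]
    (G : LabelledGraph V E A) (hG : G.IsRightResolving) (hirr : G.IsIrreducible)
    (hsep : Function.Injective G.followerSet) (j : ℕ) (hj : 2 ≤ j) (hjS : j ≤ Fintype.card V) :
    spectralRadius ℂ (G.positiveSubsetGraph j).adjMatrix < spectralRadius ℂ G.adjMatrix := by
  have hj0 : j ≠ 0 := by omega
  have : Nonempty V := Fintype.card_pos_iff.1 (by omega)
  obtain ⟨s₀, -, hs₀⟩ := Finset.exists_subset_card_eq (s := (Finset.univ : Finset V)) hjS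
  have : Nonempty (Subsets V j) := ⟨⟨s₀, hs₀⟩⟩
  have : Finite (G.SubsetEdges j) := finite_subsetEdges hj0
  obtain ⟨c, r, hr, hcr⟩ := exists_pos_mulVec_eq_smul_of_isIrreducible hirr.realAdjMatrix
  have hr0 : r ≠ 0 := fun h => (hr (Classical.arbitrary V)).ne' (congrFun h _)
  have hc := ofReal_le_spectralRadius_of_mulVec_eq_smul hr0 hcr
  rw [map_realAdjMatrix] at hc
  by_contra! hle
  obtain ⟨T, ⟨s, hs⟩, hT⟩ := hG.exists_closed_subsets hj0 hr hcr.le (hc.trans hle)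
  obtain ⟨v, hv, v', hv', hne⟩ := Finset.one_lt_card.1 (show 1 < s.1.card by rw [s.2]; omega)
  exact hne (hsep ((hG.followerSet_subset_of_closed hT hs hv hv').antisymm
    (hG.followerSet_subset_of_closed hT hs hv' hv)))

theorem mainTheorem2 {V E A : Type*} [Fintype V] [LinearOrder V] [Finite E] [Finite A]
    (X : Set (ℤ → A)) (hX : IsIrreducibleShift X)
    (G : LabelledGraph V E A) (hG : G.IsMinimalRightResolvingPresentation X)
    (j : ℕ) (hj : 2 ≤ j) (hjS : j ≤ Fintype.card V) :
    spectralRadius ℂ (G.positiveSubsetGraph j).adjMatrix < spectralRadius ℂ G.adjMatrix :=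
  mainTheorem2_general G hG.rightResolving (hG.isIrreducible hX) hG.injective_followerSet j hj hjS
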